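/- Let $n\ge 2$ and $p>1$. For a convex body $K\subset\mathbb R^n$ (compact, convex) with the origin in its interior let $h_K(v)=\sup_{x\in K}\langle x,v\rangle$ be its support function, $S(K,\cdot)$ its surface area measure on $\mathbb S^{n-1}$, and for $w\in\mathbb R^n$ put $$I_{p,K}(w)=\int_{\mathbb S^{n-1}}|\langle w,v\rangle|^p\,h_K(v)^{1-p}\,dS(K,v).$$ The $L_p$-projection body $\Pi_pK$ is the convex body with support function $h_{\Pi_pK}(v)=\bigl(\tfrac{1}{n\omega_n c_{n-2,p}}I_{p,K}(v)\bigr)^{1/p}$, where $\omega_r=\pi^{r/2}/\Gamma(1+r/2)$ and $c_{q,p}=\omega_{q+p}/(\omega_2\omega_q\omega_{p-1})$, and $\Pi_p^*K=\{x:\langle x,y\rangle\le 1\ \forall y\in\Pi_pK\}$ is its polar body. For $u\in\mathbb S^{n-1}$ let $G_{u^\perp,n-2}$ be the Grassmannian of $(n-2)$-dimensional linear subspaces of $u^\perp$, with its rotation invariant Borel probability measure $\sigma_{u^\perp,n-2}$. For an $(n-2)$-dimensional subspace $E$ and $x\in\mathbb R^n$ let $$|P_{E\wedge x,p}K|=\|P_{E^\perp}x\|\;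 I_{p,K}(v(E,x))^{1/p},$$ where $P_{E^\perp}$ is the orthogonal projection onto $E^\perp$ and $v(E,x)$ is a unit vector perpendicular to $\operatorname{span}(E,x)$. Let $L_{E,p}(K)=\{x\in E^\perp:|P_{E\wedge x,p}K|\le 1\}$ and, for $E\in G_{u^\perp,n-2}$ and $s\in\mathbb R$, let $L_{E,p,u,s}(K)=\{y\in E^\perp\cap u^\perp:|P_{E\wedge(y+su),p}K|\le1\}$, with length $|L_{E,p,u,s}(K)|$. On the bundle $V_{n-1,u}=\{(E,x):E\in G_{u^\perp,n-2},\ x\in E^\perp\}$ consider the Borel measure $\mu_{n-1,u}(dE,dx)=|\langle x,u\rangle|^{n-2}\,\mathcal L_{E^\perp}(dx)\,\sigma_{u^\perp,n-2}(dE)$, where $\mathcal L_{E^\perp}$ is the two-dimensional Lebesgue measure on $E^\perp$, and the $L_p$-projection Rolodex $L_{n-1,u,p}(K)=\{(E,x)\in V_{n-1,u}: x\in L_{E,p}(K)\}$. Then there is a constant $\tilde c_{n,p}>0$, depending only on $n$ and $p$, such that for every convex body $K\subset\mathbb R^n$ with the origin in its interior and every $u\in\mathbb S^{n-1}$ $$\operatorname{vol}_n(\Pi_p^*K)=\tilde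 c_{n,p}\,\mu_{n-1,u}\bigl(L_{n-1,u,p}(K)\bigr)=\tilde c_{n,p}\int_{G_{u^\perp,n-2}}\int_{\mathbb R}|s|^{n-2}\,|L_{E,p,u,s}(K)|\,ds\,\sigma_{u^\perp,n-2}(dE).$$ -/

import Mathlib

open MeasureTheory Metric Module
open scoped RealInnerProductSpace ENNReal MeasureTheory

noncomputable section

namespace LpRolodex

/-- Euclidean space `ℝⁿ`. -/
abbrev Euc (n : ℕ) : Type := EuclideanSpace ℝ (Fin n)

/-- The unit sphere `𝕊ⁿ⁻¹` of `ℝⁿ`. -/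
abbrev UnitSphere (n : ℕ) : Type := sphere (0 : Euc n) 1

variable {n : ℕ}

/-! ### Convex bodies, surface area measure, polar projection bodies -/

/-- The support function `h_K(v) = sup_{x ∈ K} ⟪x, v⟫`. -/
def supportFn (K : ConvexBody (Euc n)) (v : Euc n) : ℝ :=
  sSup ((fun x : Euc n => ⟪x, v⟫) '' (K : Set (Euc n)))

/-- The polar set `{x : ⟪x, y⟫ ≤ 1 for all y ∈ A}`. -/
def polarSet (A : Set (Euc n)) : Set (Euc n) := {x | ∀ y ∈ A, ⟪x, y⟫ ≤ 1}

/-- `v` is an outer unit normal vector of `K` at the point `x` of `K`. -/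
def IsOuterNormal (K : ConvexBody (Euc n)) (x v : Euc n) : Prop :=
  x ∈ K ∧ ‖v‖ = 1 ∧ ∀ y ∈ K, ⟪y, v⟫ ≤ ⟪x, v⟫

/-- The regular boundary points of `K`: those with exactly one outer unit normal. For a convex body
with interior points they form `∂K` up to a set of `(n-1)`-dimensional Hausdorff measure zero. -/
def regularBoundary (K : ConvexBody (Euc n)) : Set (Euc n) := {x | ∃! v, IsOuterNormal K x v}

/-- The Gauss map `ν^K`; its values matter only on the regular boundary. -/
def gaussMap (K : ConvexBody (Euc n)) (x : Euc n) : Euc n := Classical.epsilon (IsOuterNormal K x)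

/-- The surface area measure `S(K, ·)`, i.e. `S(K, ω) = ℋⁿ⁻¹((ν^K)⁻¹(ω))`, as a Borel measure on
`ℝⁿ` that lives on the unit sphere. `μHE[n - 1]` is Hausdorff measure normalised so as to agree
with Lebesgue measure on `(n-1)`-dimensional subspaces. -/
def surfaceAreaMeasure (K : ConvexBody (Euc n)) : Measure (Euc n) :=
  ((μHE[n - 1] : Measure (Euc n)).restrict (regularBoundary K)).map (gaussMap K)

theorem isCompact_outerNormals (K : ConvexBody (Euc n)) :
    IsCompact {q : Euc n × Euc n | IsOuterNormal K q.1 q.2} := by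
  refine (K.isCompact.prod (isCompact_sphere (0 : Euc n) 1)).of_isClosed_subset ?_ ?_
  · have : {q : Euc n × Euc n | IsOuterNormal K q.1 q.2} =
        {q | q.1 ∈ (K : Set (Euc n))} ∩ ({q | ‖q.2‖ = 1} ∩
          ⋂ y ∈ (K : Set (Euc n)), {q | ⟪y, q.2⟫ ≤ ⟪q.1, q.2⟫}) := by
      ext q; simp [IsOuterNormal]
    rw [this]
    refine (K.isClosed.preimage continuous_fst).inter ((isClosed_eq (by fun_prop)
      continuous_const).inter (isClosed_biInter fun y _ => isClosed_le
      (continuous_const.inner continuous_snd) (continuous_fst.inner continuous_snd)))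
  · rintro ⟨x, v⟩ ⟨h1, h2, -⟩
    exact ⟨h1, mem_sphere_zero_iff_norm.2 h2⟩

theorem measurableSet_regularBoundary (K : ConvexBody (Euc n)) :
    MeasurableSet (regularBoundary K) := by
  have hC := isCompact_outerNormals K
  have h1 : IsCompact {x | ∃ v, IsOuterNormal K x v} := by
    convert! hC.image continuous_fst using 1
    ext x; simp
  have h2 : ∀ k : ℕ, IsCompact {x | ∃ v w, IsOuterNormal K x v ∧ IsOuterNormal K x w ∧
      1 / ((k : ℝ) + 1) ≤ ‖v - w‖} := by
    intro k
    have hc : IsClosed {q : (Euc n × Euc n) × (Euc n × Euc n) |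
        q.1.1 = q.2.1 ∧ 1 / ((k : ℝ) + 1) ≤ ‖q.1.2 - q.2.2‖} :=
      (isClosed_eq (f := fun q : (Euc n × Euc n) × (Euc n × Euc n) => q.1.1)
        (g := fun q => q.2.1) (by fun_prop) (by fun_prop)).inter
        (isClosed_le (f := fun _ : (Euc n × Euc n) × (Euc n × Euc n) => 1 / ((k : ℝ) + 1))
          (g := fun q => ‖q.1.2 - q.2.2‖) (by fun_prop) (by fun_prop))
    convert! ((hC.prod hC).inter_right hc).image (continuous_fst.comp continuous_fst) using 1
    ext x
    simp only [Set.mem_ofPred_eq, Set.mem_image, Set.mem_inter_iff, Set.mem_prod, Prod.exists,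
      Function.comp_apply]
    constructor
    · rintro ⟨v, w, hv, hw, h⟩
      exact ⟨x, v, x, w, ⟨⟨hv, hw⟩, rfl, h⟩, rfl⟩
    · rintro ⟨x', v, x'', w, ⟨⟨hv, hw⟩, h, h'⟩, rfl⟩
      subst h
      exact ⟨v, w, hv, hw, h'⟩
  have : regularBoundary K = {x | ∃ v, IsOuterNormal K x v} \ ⋃ k : ℕ, {x | ∃ v w,
      IsOuterNormal K x v ∧ IsOuterNormal K x w ∧ 1 / ((k : ℝ) + 1) ≤ ‖v - w‖} := by
    ext x
    simp only [regularBoundary, Set.mem_ofPred_eq, Set.mem_sdiff, Set.mem_iUnion]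
    constructor
    · rintro ⟨v, hv, huniq⟩
      refine ⟨⟨v, hv⟩, ?_⟩
      rintro ⟨k, v', w', hv', hw', h⟩
      rw [huniq v' hv', huniq w' hw', sub_self, norm_zero] at h
      exact absurd h (not_le.2 (by positivity))
    · rintro ⟨⟨v, hv⟩, h⟩
      refine ⟨v, hv, fun w hw => ?_⟩
      by_contra hne
      obtain ⟨k, hk⟩ := exists_nat_one_div_lt (norm_pos_iff.2 (sub_ne_zero.2 hne))
      exact h ⟨k, w, v, hw, hv, hk.le⟩
  rw [this]
  exact h1.measurableSet.diff (.iUnion fun k => (h2 k).measurableSet)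

theorem aemeasurable_gaussMap (K : ConvexBody (Euc n)) :
    AEMeasurable (gaussMap K)
      ((μHE[n - 1] : Measure (Euc n)).restrict (regularBoundary K)) := by
  have hR := measurableSet_regularBoundary K
  have hspec : ∀ x ∈ regularBoundary K, IsOuterNormal K x (gaussMap K x) := fun x hx =>
    Classical.epsilon_spec hx.exists
  refine aemeasurable_restrict_of_measurable_subtype hR ?_
  refine measurable_of_isClosed fun C hC => ?_
  have h1 : IsCompact {x | ∃ v ∈ C, IsOuterNormal K x v} := by
    convert! ((isCompact_outerNormals K).inter_right (hC.preimage continuous_snd)).image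
      continuous_fst using 1
    ext x; simp [and_comm]
  convert! measurable_subtype_coe h1.measurableSet using 1
  ext ⟨x, hx⟩
  constructor
  · intro h
    exact ⟨_, h, hspec x hx⟩
  · rintro ⟨v, hv, hv'⟩
    have : gaussMap K x = v := hx.unique (hspec x hx) hv'
    rw [Set.mem_preimage]
    exact this ▸ hv

/-- `S(K, ω) = ℋⁿ⁻¹((ν^K)⁻¹(ω))` for Borel sets `ω`. -/
theorem surfaceAreaMeasure_apply (K : ConvexBody (Euc n)) {ω : Set (Euc n)}
    (hω : MeasurableSet ω) :
    surfaceAreaMeasure K ω = μHE[n - 1] {x | x ∈ regularBoundary K ∧ gaussMap K x ∈ ω} := by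
  rw [surfaceAreaMeasure, Measure.map_apply_of_aemeasurable (aemeasurable_gaussMap K) hω,
    Measure.restrict_apply₀' (measurableSet_regularBoundary K).nullMeasurableSet]
  congr 1
  ext x
  exact and_comm

/-- `ω_r = π^{r/2} / Γ(1 + r/2)`. -/
def ballVol (r : ℝ) : ℝ := Real.pi ^ (r / 2) / Real.Gamma (1 + r / 2)

/-- `c_{q,p} = ω_{q+p} / (ω_2 ω_q ω_{p-1})`. -/
def lpConst (q p : ℝ) : ℝ := ballVol (q + p) / (ballVol 2 * ballVol q * ballVol (p - 1))

/-- `∫_{𝕊ⁿ⁻¹} |⟪w, θ⟫|^p h_K(θ)^{1-p} dS(K, θ)`. -/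
def lpEnergy (p : ℝ) (K : ConvexBody (Euc n)) (w : Euc n) : ℝ :=
  ∫ θ, |⟪w, θ⟫| ^ p * supportFn K θ ^ (1 - p) ∂(surfaceAreaMeasure K)

/-- The support function `h_{Π_p K}` of the `L_p`-projection body. -/
def lpProjectionSupport (p : ℝ) (K : ConvexBody (Euc n)) (v : Euc n) : ℝ :=
  (1 / (n * ballVol n * lpConst ((n : ℝ) - 2) p) * lpEnergy p K v) ^ (1 / p)

/-- The `L_p`-projection body `Π_p K`: the convex body with support function `h_{Π_p K}`. -/
def lpProjectionBody (p : ℝ) (K : ConvexBody (Euc n)) : Set (Euc n) :=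
  {x | ∀ v : Euc n, ‖v‖ = 1 → ⟪x, v⟫ ≤ lpProjectionSupport p K v}

/-- The polar `L_p`-projection body `Π_p^* K = (Π_p K)^*`. -/
def polarLpProjectionBody (p : ℝ) (K : ConvexBody (Euc n)) : Set (Euc n) :=
  polarSet (lpProjectionBody p K)

/-! ### The Grassmannian of `(n-2)`-dimensional subspaces of `u^⊥` -/

/-- `u^⊥`. -/
abbrev perp (u : UnitSphere n) : Submodule ℝ (Euc n) := (ℝ ∙ (u : Euc n))ᗮ

/-- `G_{u^⊥, n-2}`, the `(n-2)`-dimensional linear subspaces of `u^⊥`. -/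
@[ext]
structure Gr (u : UnitSphere n) : Type where
  space : Submodule ℝ (Euc n)
  le_perp : space ≤ perp u
  finrank_eq : finrank ℝ space = n - 2

/-- The orthogonal projection `P_E`. -/
def Gr.proj {u : UnitSphere n} (E : Gr u) : Euc n →L[ℝ] Euc n := E.space.starProjection

/-- The topology of `G_{u^⊥, n-2}`, that of the metric `d(E, F) = ‖P_E - P_F‖`. -/
instance (u : UnitSphere n) : TopologicalSpace (Gr u) := .induced Gr.proj inferInstance

instance (u : UnitSphere n) : MeasurableSpace (Gr u) := borel _

instance (u : UnitSphere n) : BorelSpace (Gr u) := ⟨rfl⟩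

/-- The unit sphere of `u^⊥`. -/
abbrev PerpSphere (u : UnitSphere n) : Type := sphere (0 : perp u) 1

/-- The orthogonal family `(u, w)` for a unit vector `w` of `u^⊥`. -/
theorem orthonormal_pair (u : UnitSphere n) (w : PerpSphere u) :
    Orthonormal ℝ ![(u : Euc n), ((w : perp u) : Euc n)] := by
  have hu : ‖(u : Euc n)‖ = 1 := norm_eq_of_mem_sphere u
  have hw : ‖((w : perp u) : Euc n)‖ = 1 := norm_eq_of_mem_sphere w
  have h := Submodule.mem_orthogonal_singleton_iff_inner_right.1 (w : perp u).2
  have h' : ⟪((w : perp u) : Euc n), (u : Euc n)⟫ = 0 := by rw [real_inner_comm]; exact h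
  constructor
  · intro i; fin_cases i <;> simp [hu, hw]
  · intro i j hij
    fin_cases i <;> fin_cases j <;> simp_all

/-- The element `u^⊥ ∩ w^⊥` of `G_{u^⊥, n-2}` for a unit vector `w` of `u^⊥`. -/
def Gr.ofNormal (u : UnitSphere n) (w : PerpSphere u) : Gr u :=
  ⟨perp u ⊓ (ℝ ∙ ((w : perp u) : Euc n))ᗮ, inf_le_left, by
    have h1 := finrank_span_eq_card (orthonormal_pair u w).linearIndependent
    have h2 := Submodule.finrank_add_finrank_orthogonal
      (Submodule.span ℝ (Set.range ![(u : Euc n), ((w : perp u) : Euc n)]))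
    rw [h1, Matrix.range_cons, Matrix.range_cons, Matrix.range_empty, Set.union_empty,
      Submodule.span_union, ← Submodule.inf_orthogonal] at h2
    rw [Fintype.card_fin, finrank_euclideanSpace_fin] at h2
    exact Nat.eq_sub_of_add_eq' h2⟩

/-- The uniform probability measure on the unit sphere of `u^⊥`. -/
def uniformSphere (u : UnitSphere n) : Measure (PerpSphere u) :=
  ((volume : Measure (perp u)).toSphere Set.univ)⁻¹ • (volume : Measure (perp u)).toSphere

/-- The uniform (rotation invariant) probability measure `σ_{u^⊥, n-2}` on `G_{u^⊥, n-2}`, built as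
the law of `u^⊥ ∩ w^⊥` for a uniformly distributed unit vector `w` of `u^⊥`. -/
def grMeasure (u : UnitSphere n) : Measure (Gr u) := (uniformSphere u).map (Gr.ofNormal u)

theorem mem_ofNormal (u : UnitSphere n) (w : PerpSphere u) (z : Euc n) :
    z ∈ (Gr.ofNormal u w).space ↔ ⟪(u : Euc n), z⟫ = 0 ∧ ⟪((w : perp u) : Euc n), z⟫ = 0 := by
  change z ∈ perp u ⊓ (ℝ ∙ ((w : perp u) : Euc n))ᗮ ↔ _
  rw [Submodule.mem_inf, Submodule.mem_orthogonal_singleton_iff_inner_right,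
    Submodule.mem_orthogonal_singleton_iff_inner_right]

theorem isInducing_proj (u : UnitSphere n) : Topology.IsInducing (Gr.proj (u := u)) := ⟨rfl⟩

theorem proj_injective (u : UnitSphere n) : Function.Injective (Gr.proj (u := u)) := by
  intro E F h
  exact Gr.ext (Submodule.starProjection_inj.1 h)

theorem proj_ofNormal (u : UnitSphere n) (w : PerpSphere u) :
    (Gr.ofNormal u w).proj = ContinuousLinearMap.id ℝ (Euc n)
      - (innerSL ℝ (u : Euc n)).smulRight (u : Euc n)
      - (innerSL ℝ ((w : perp u) : Euc n)).smulRight ((w : perp u) : Euc n) := by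
  ext1 x
  have hu : ‖(u : Euc n)‖ = 1 := norm_eq_of_mem_sphere u
  have hw : ‖((w : perp u) : Euc n)‖ = 1 := norm_eq_of_mem_sphere w
  have h := Submodule.mem_orthogonal_singleton_iff_inner_right.1 (w : perp u).2
  have h' : ⟪((w : perp u) : Euc n), (u : Euc n)⟫ = 0 := by rw [real_inner_comm]; exact h
  refine (Submodule.eq_starProjection_of_mem_of_inner_eq_zero (K := (Gr.ofNormal u w).space)
    ?_ ?_)
  · rw [mem_ofNormal]
    simp [inner_sub_right, inner_smul_right, h, h', hu, hw]
  · intro z hz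
    obtain ⟨h1, h2⟩ := (mem_ofNormal u w z).1 hz
    simp [inner_sub_left, inner_smul_left, h1, h2]

instance (u : UnitSphere n) : T2Space (Gr u) :=
  .of_injective_continuous (proj_injective u) (isInducing_proj u).continuous

instance (u : UnitSphere n) : SecondCountableTopology (Gr u) :=
  (isInducing_proj u).secondCountableTopology

theorem continuous_ofNormal (u : UnitSphere n) : Continuous (Gr.ofNormal u) := by
  rw [(isInducing_proj u).continuous_iff]
  have : Gr.proj ∘ Gr.ofNormal u = fun w => _ := funext (proj_ofNormal u)
  rw [this]
  fun_prop

theorem finrank_perp (u : UnitSphere n) : finrank ℝ (perp u) = n - 1 := by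
  have hu : (u : Euc n) ≠ 0 := by
    have : ‖(u : Euc n)‖ = 1 := norm_eq_of_mem_sphere u
    intro h; simp [h] at this
  have h := Submodule.finrank_add_finrank_orthogonal (ℝ ∙ (u : Euc n))
  rw [finrank_span_singleton hu, finrank_euclideanSpace_fin] at h
  exact Nat.eq_sub_of_add_eq' h

theorem ofNormal_surjective (hn : 2 ≤ n) (u : UnitSphere n) :
    Function.Surjective (Gr.ofNormal u) := by
  rintro ⟨E, hE, hd⟩
  have h1 := finrank_perp u
  obtain ⟨w, hw, hwE⟩ : ∃ w : perp u, ‖w‖ = 1 ∧ (w : Euc n) ∈ Eᗮ := by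
    have h2 : ¬ perp u ≤ E := fun h => by
      have := Submodule.finrank_mono h
      omega
    obtain ⟨x, hx, hxE⟩ := SetLike.not_le_iff_exists.1 h2
    set y : Euc n := x - E.starProjection x with hy
    have hyE : y ∈ Eᗮ := Submodule.sub_starProjection_mem_orthogonal x
    have hyu : y ∈ perp u := Submodule.sub_mem _ hx (hE (Submodule.starProjection_apply_mem E x))
    have hy0 : y ≠ 0 := fun h => hxE (by
      rw [sub_eq_zero.1 (hy.symm.trans h)]
      exact Submodule.starProjection_apply_mem E x)
    refine ⟨⟨‖y‖⁻¹ • y, Submodule.smul_mem _ _ hyu⟩, ?_, Submodule.smul_mem _ _ hyE⟩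
    rw [Submodule.coe_norm, norm_smul, norm_inv, norm_norm]
    exact inv_mul_cancel₀ (norm_ne_zero_iff.2 hy0)
  refine ⟨⟨w, mem_sphere_zero_iff_norm.2 hw⟩, Gr.ext ?_⟩
  refine (Submodule.eq_of_le_of_finrank_eq ?_ ?_).symm
  · intro z hz
    rw [mem_ofNormal]
    exact ⟨Submodule.mem_orthogonal_singleton_iff_inner_right.1 (hE hz),
      Submodule.inner_left_of_mem_orthogonal hz hwE⟩
  · exact hd.trans (Gr.ofNormal u ⟨w, mem_sphere_zero_iff_norm.2 hw⟩).finrank_eq.symm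

/-- `σ_{u^⊥, n-2}` is a probability measure. -/
theorem isProbabilityMeasure_grMeasure (hn : 2 ≤ n) (u : UnitSphere n) :
    IsProbabilityMeasure (grMeasure u) := by
  have h0 : (volume : Measure (perp u)).toSphere ≠ 0 := by
    rw [Ne, Measure.toSphere_eq_zero_iff_finrank, finrank_perp]
    omega
  have : IsProbabilityMeasure (uniformSphere u) := ⟨by
    rw [uniformSphere, Measure.smul_apply, smul_eq_mul]
    exact ENNReal.inv_mul_cancel (by rwa [Ne, Measure.measure_univ_eq_zero]) (measure_ne_top _ _)⟩
  exact Measure.isProbabilityMeasure_map (continuous_ofNormal u).measurable.aemeasurable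

open scoped Pointwise in
/-- `σ_{u^⊥, n-2}` is invariant under the rotations and reflections of `u^⊥`, i.e. the linear
isometries `g` of `ℝⁿ` that fix `u`. -/
theorem map_grMeasure (hn : 2 ≤ n) (u : UnitSphere n) (g : Euc n ≃ₗᵢ[ℝ] Euc n)
    (hg : g u = (u : Euc n)) (T : Gr u → Gr u)
    (hT : ∀ E, (T E).space = E.space.map (g.toLinearEquiv : Euc n →ₗ[ℝ] Euc n)) :
    (grMeasure u).map T = grMeasure u := by
  have hmem : ∀ x, x ∈ perp u → g x ∈ perp u := fun x hx => by
    rw [Submodule.mem_orthogonal_singleton_iff_inner_right] at hx ⊢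
    rw [← hx, ← g.inner_map_map (u : Euc n) x, hg]
  let g₀ : perp u →ₗᵢ[ℝ] perp u :=
    ⟨(g.toLinearEquiv : Euc n →ₗ[ℝ] Euc n).restrict hmem, fun x => g.norm_map x⟩
  let g' : perp u ≃ₗᵢ[ℝ] perp u := g₀.toLinearIsometryEquiv rfl
  have hg' : ∀ x, (g' x : Euc n) = g x := fun x => rfl
  let S : PerpSphere u → PerpSphere u := fun w =>
    ⟨g' w, by rw [mem_sphere_zero_iff_norm, g'.norm_map]; exact norm_eq_of_mem_sphere w⟩
  have hS : Continuous S := by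
    refine Continuous.subtype_mk ?_ _
    exact g'.continuous.comp continuous_subtype_val
  have hTS : ∀ w, T (Gr.ofNormal u w) = Gr.ofNormal u (S w) := by
    intro w
    refine Gr.ext (Submodule.eq_of_le_of_finrank_eq ?_ ?_)
    · rw [hT]
      rintro _ ⟨z, hz, rfl⟩
      obtain ⟨h1, h2⟩ := (mem_ofNormal u w z).1 hz
      refine (mem_ofNormal u _ _).2 ⟨?_, ?_⟩
      · rw [← h1, ← g.inner_map_map (u : Euc n) z, hg]; rfl
      · rw [← h2, ← g.inner_map_map _ z]; rfl
    · rw [(T _).finrank_eq, (Gr.ofNormal u _).finrank_eq]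
  have hc := continuous_ofNormal u
  have hTm : Measurable T := by
    rw [← hc.measurable.measurable_comp_iff_of_surjective (ofNormal_surjective hn u)]
    have : T ∘ Gr.ofNormal u = Gr.ofNormal u ∘ S := funext hTS
    rw [this]
    exact (hc.comp hS).measurable
  have hinv : (volume : Measure (perp u)).toSphere.map S = (volume : Measure (perp u)).toSphere := by
    ext s hs
    rw [Measure.map_apply hS.measurable hs, Measure.toSphere_apply' _ (hS.measurable hs),
      Measure.toSphere_apply' _ hs, ← g'.measurePreserving.measure_preimage_emb
        g'.toMeasurableEquiv.measurableEmbedding (Set.Ioo (0 : ℝ) 1 • (Subtype.val '' s))]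
    congr 2
    ext x
    constructor
    · rintro ⟨c, hc, _, ⟨w, hw, rfl⟩, rfl⟩
      exact ⟨c, hc, _, ⟨S w, hw, rfl⟩, (g'.map_smul c (w : perp u)).symm⟩
    · rintro ⟨c, hc, _, ⟨y, hy, rfl⟩, hx⟩
      have hw : g'.symm (y : perp u) ∈ sphere (0 : perp u) 1 := by
        rw [mem_sphere_zero_iff_norm, g'.symm.norm_map]
        exact norm_eq_of_mem_sphere y
      refine ⟨c, hc, _, ⟨⟨_, hw⟩, ?_, rfl⟩, ?_⟩
      · have : S ⟨_, hw⟩ = y := Subtype.ext (g'.apply_symm_apply _)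
        rw [Set.mem_preimage, this]
        exact hy
      · apply g'.injective
        rw [← hx]
        simp
  rw [grMeasure, Measure.map_map hTm hc.measurable]
  have : T ∘ Gr.ofNormal u = Gr.ofNormal u ∘ S := funext hTS
  rw [this, ← Measure.map_map hc.measurable hS.measurable, uniformSphere, Measure.map_smul, hinv]

/-! ### The bundle, its measure and the Rolodex -/

/-- The vector bundle `V_{n-1,u} = {(E, x) : E ∈ G_{u^⊥, n-2}, x ∈ E^⊥}`. -/
@[ext]
structure Bundle (u : UnitSphere n) : Type where
  base : Gr u
  vec : Euc n
  vec_mem : vec ∈ base.spaceᗮ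

/-- The inclusion of `V_{n-1,u}` in `G_{u^⊥, n-2} × ℝⁿ`. -/
def Bundle.toProd {u : UnitSphere n} (q : Bundle u) : Gr u × Euc n := (q.base, q.vec)

/-- The subspace topology. -/
instance (u : UnitSphere n) : TopologicalSpace (Bundle u) := .induced Bundle.toProd inferInstance

instance (u : UnitSphere n) : MeasurableSpace (Bundle u) := borel _

instance (u : UnitSphere n) : BorelSpace (Bundle u) := ⟨rfl⟩

/-- The measure `|⟪x, u⟫|^{n-2} ℒ_{E^⊥}(dx)` on the fibre `{E} × E^⊥` of `V_{n-1,u}`. -/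
def fiberMeasure {u : UnitSphere n} (E : Gr u) : Measure (Bundle u) :=
  ((volume : Measure E.spaceᗮ).withDensity
    (fun x => ENNReal.ofReal (|⟪(x : Euc n), (u : Euc n)⟫| ^ (n - 2)))).map
      (fun x : E.spaceᗮ => ⟨E, x, x.2⟩)

/-- The measure `μ_{n-1,u}(dE, dx) = |⟪x, u⟫|^{n-2} ℒ_{E^⊥}(dx) σ_{u^⊥, n-2}(dE)` on `V_{n-1,u}`. -/
def rolodexMeasure (u : UnitSphere n) : Measure (Bundle u) := (grMeasure u).bind fiberMeasure

theorem isInducing_toProd (u : UnitSphere n) :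
    Topology.IsInducing (Bundle.toProd (u := u)) := ⟨rfl⟩

theorem measurable_fiberIncl {u : UnitSphere n} (E : Gr u) :
    Measurable fun x : E.spaceᗮ => (⟨E, x, x.2⟩ : Bundle u) := by
  refine Continuous.measurable ?_
  exact (isInducing_toProd u).continuous_iff.2 (continuous_const.prodMk continuous_subtype_val)

theorem measurable_fiberMeasure (hn : 2 ≤ n) (u : UnitSphere n) :
    Measurable (fiberMeasure : Gr u → Measure (Bundle u)) := by
  have hc := continuous_ofNormal u
  rw [← hc.measurable.measurable_comp_iff_of_surjective (ofNormal_surjective hn u)]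
  let Φ : PerpSphere u × EuclideanSpace ℝ (Fin 2) → Bundle u := fun q =>
    ⟨Gr.ofNormal u q.1, q.2 0 • (u : Euc n) + q.2 1 • ((q.1 : perp u) : Euc n),
      (Submodule.mem_orthogonal' _ _).2 fun z hz => by
        obtain ⟨h1, h2⟩ := (mem_ofNormal u q.1 z).1 hz
        simp [inner_add_left, inner_smul_left, h1, h2]⟩
  have hΦ : Continuous Φ := by
    refine (isInducing_toProd u).continuous_iff.2 ?_
    change Continuous fun q : PerpSphere u × EuclideanSpace ℝ (Fin 2) =>
      (Gr.ofNormal u q.1, q.2 0 • (u : Euc n) + q.2 1 • ((q.1 : perp u) : Euc n))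
    fun_prop
  let ν : Measure (EuclideanSpace ℝ (Fin 2)) :=
    volume.withDensity fun a => ENNReal.ofReal (|a 0| ^ (n - 2))
  have key : ∀ w, fiberMeasure (Gr.ofNormal u w) = ν.map fun a => Φ (w, a) := by
    intro w
    have hu : ‖(u : Euc n)‖ = 1 := norm_eq_of_mem_sphere u
    have h := Submodule.mem_orthogonal_singleton_iff_inner_right.1 (w : perp u).2
    have h' : ⟪((w : perp u) : Euc n), (u : Euc n)⟫ = 0 := by rw [real_inner_comm]; exact h
    have hmem : ∀ i, ![(u : Euc n), ((w : perp u) : Euc n)] i ∈ (Gr.ofNormal u w).spaceᗮ := by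
      intro i
      refine (Submodule.mem_orthogonal' _ _).2 fun z hz => ?_
      obtain ⟨h1, h2⟩ := (mem_ofNormal u w z).1 hz
      fin_cases i
      · exact h1
      · exact h2
    let v : Fin 2 → (Gr.ofNormal u w).spaceᗮ := fun i => ⟨_, hmem i⟩
    have hv : Orthonormal ℝ v := by
      exact ⟨fun i => (orthonormal_pair u w).1 i, fun i j hij => (orthonormal_pair u w).2 hij⟩
    have hdim : Fintype.card (Fin 2) = finrank ℝ (Gr.ofNormal u w).spaceᗮ := by
      have := Submodule.finrank_add_finrank_orthogonal (Gr.ofNormal u w).space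
      rw [(Gr.ofNormal u w).finrank_eq, finrank_euclideanSpace_fin] at this
      rw [Fintype.card_fin]
      omega
    let b := OrthonormalBasis.mk hv
      (hv.linearIndependent.span_eq_top_of_card_eq_finrank' hdim).ge
    have hb := b.measurePreserving_repr_symm
    have hval : ∀ a, (b.repr.symm a : Euc n)
        = a 0 • (u : Euc n) + a 1 • ((w : perp u) : Euc n) := by
      intro a
      rw [← b.sum_repr_symm a]
      simp [b, v, Fin.sum_univ_two]
    have hι : Measurable fun x : (Gr.ofNormal u w).spaceᗮ =>
        (⟨Gr.ofNormal u w, x, x.2⟩ : Bundle u) := measurable_fiberIncl _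
    ext A hA
    have hm : Measurable fun a => Φ (w, a) := (hΦ.comp (Continuous.prodMk_right w)).measurable
    rw [fiberMeasure, Measure.map_apply hι hA, Measure.map_apply hm hA,
      withDensity_apply _ (hι hA), withDensity_apply _ (hm hA),
      ← hb.setLIntegral_comp_preimage (hι hA) (by fun_prop)]
    have hset : b.repr.symm ⁻¹' ((fun x : (Gr.ofNormal u w).spaceᗮ =>
        (⟨Gr.ofNormal u w, x, x.2⟩ : Bundle u)) ⁻¹' A) =
        (fun a => Φ (w, a)) ⁻¹' A := by
      ext a
      have : (⟨Gr.ofNormal u w, b.repr.symm a, (b.repr.symm a).2⟩ : Bundle u)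
          = Φ (w, a) := Bundle.ext rfl (hval a)
      rw [Set.mem_preimage, Set.mem_preimage, this, Set.mem_preimage]
    rw [hset]
    refine lintegral_congr fun a => ?_
    rw [hval, inner_add_left, inner_smul_left, inner_smul_left, h', real_inner_self_eq_norm_sq, hu]
    simp
  refine Measure.measurable_of_measurable_coe _ fun A hA => ?_
  have hm : ∀ w, Measurable fun a => Φ (w, a) := fun w =>
    (hΦ.comp (Continuous.prodMk_right w)).measurable
  have : ∀ w, (fiberMeasure ∘ Gr.ofNormal u) w A = ν (Prod.mk w ⁻¹' (Φ ⁻¹' A)) := by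
    intro w
    rw [Function.comp_apply, key, Measure.map_apply (hm w) hA]
    rfl
  simp_rw [this]
  exact measurable_measure_prodMk_left (hΦ.measurable hA)

/-- `μ_{n-1,u}(A) = ∫_G ∫_{E^⊥} 1_A(E, x) |⟪x, u⟫|^{n-2} dx dσ(E)` for Borel sets `A`. -/
theorem rolodexMeasure_apply (hn : 2 ≤ n) (u : UnitSphere n) {A : Set (Bundle u)}
    (hA : MeasurableSet A) :
    rolodexMeasure u A = ∫⁻ E, (∫⁻ x : E.spaceᗮ,
      ({x : E.spaceᗮ | (⟨E, x, x.2⟩ : Bundle u) ∈ A}).indicator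
        (fun x => ENNReal.ofReal (|⟪(x : Euc n), (u : Euc n)⟫| ^ (n - 2))) x) ∂(grMeasure u) := by
  rw [rolodexMeasure, Measure.bind_apply hA (measurable_fiberMeasure hn u).aemeasurable]
  refine lintegral_congr fun E => ?_
  have hA' := measurable_fiberIncl E hA
  rw [fiberMeasure, Measure.map_apply (measurable_fiberIncl E) hA, withDensity_apply _ hA',
    ← lintegral_indicator hA']
  rfl

/-- A choice of the unit vector `v(E, x)` perpendicular to `span {x, E}`; for `E` of dimension
`n - 2` and `x ∉ E` it is unique up to sign. -/
def unitNormal (E : Submodule ℝ (Euc n)) (x : Euc n) : Euc n :=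
  Classical.epsilon fun w => ‖w‖ = 1 ∧ w ∈ (E ⊔ ℝ ∙ x)ᗮ

/-- `|P_{E ∧ x, p} K| = ‖P_{E^⊥} x‖ (∫_{𝕊ⁿ⁻¹} |⟪v(E, x), θ⟫|^p h_K(θ)^{1-p} dS(K, θ))^{1/p}`. -/
def wedgeProj (p : ℝ) (K : ConvexBody (Euc n)) (E : Submodule ℝ (Euc n)) (x : Euc n) : ℝ :=
  ‖Eᗮ.starProjection x‖ * lpEnergy p K (unitNormal E x) ^ (1 / p)

/-- The `L_{E,p}`-projection polar body `L_{E,p}(K) ⊆ E^⊥`. -/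
def lpFiber (p : ℝ) (K : ConvexBody (Euc n)) (E : Submodule ℝ (Euc n)) : Set (Euc n) :=
  {x | x ∈ Eᗮ ∧ wedgeProj p K E x ≤ 1}

/-- The `L_p`-projection Rolodex `L_{n-1,u,p}(K) ⊆ V_{n-1,u}`. -/
def rolodex (p : ℝ) (K : ConvexBody (Euc n)) (u : UnitSphere n) : Set (Bundle u) :=
  {q | q.vec ∈ lpFiber p K q.base.space}

/-- The section `L_{E,p,u,s}(K) = {y ∈ E^⊥ ∩ u^⊥ : |P_{E ∧ (y + s u), p} K| ≤ 1}`. -/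
def lpSection (p : ℝ) (K : ConvexBody (Euc n)) (u : UnitSphere n) (E : Gr u) (s : ℝ) :
    Set ↥(E.spaceᗮ ⊓ perp u) :=
  {y | wedgeProj p K E.space ((y : Euc n) + s • (u : Euc n)) ≤ 1}

end LpRolodex

end

noncomputable section

namespace LpRolodex

variable {n : ℕ}

/-! ### Finiteness of the surface area measure -/

/-! Everything reduces to computing the volume of `{N ≤ 1}` in cylindrical coordinates around the
axis `u`, where `N x = lpEnergy p K x ^ (1/p)`.

`N` is a continuous seminorm, being the `L^p` norm of `θ ↦ ⟪x, θ⟫ h_K(θ)^((1-p)/p)` for the surface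
area measure (`exists_seminorm_eq_lpEnergy_rpow`). This needs that measure to be finite and `h_K` to
be bounded below on the sphere; the latter is where the interior origin enters. The support function
of the projection body is `b N` with `b` depending only on `n` and `p`, so by Hahn–Banach the polar
body is `{b N ≤ 1}`, of volume `b⁻ⁿ vol {N ≤ 1}` (`volume_polarLpProjectionBody`).

Write `E = u^⊥ ∩ w^⊥`, so that `E^⊥` is the plane of `u` and `w`. The normal `v(E, x)` to `x = s u +
t w` is, up to sign, the normalised quarter turn `s w - t u`, whence `|P_{E ∧ x, p} K| = N (s w - t
u)` (`wedgeProj_ofNormal`). Each fibre of the Rolodex is thus a planar section of `{N ≤ 1}` through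
the axis `u`, turned by a right angle, and `lpSection` at height `s` is the chord of that section
parallel to `u` over the point `s w`.

Integrating chord lengths over `u^⊥` and using polar coordinates there gives the density `s^(n-2)`;
central symmetry replaces `s > 0` by all real `s` at the cost of a factor 2
(`two_mul_volume_seminorm_ball`). Normalising the sphere of `u^⊥` yields the integral over the
Grassmannian, and Fubini in each fibre identifies it with the Rolodex measure
(`lintegral_fiber_rolodex`). -/

theorem hausdorffMeasure_sphere_pi_lt_top (m : ℕ) (R : ℝ) :
    (μH[(m : ℝ)] : Measure (Fin (m + 1) → ℝ)) (sphere 0 R) < ∞ := by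
  have hlip : ∀ (i : Fin (m + 1)) (c : ℝ),
      LipschitzWith 1 (fun f : Fin m → ℝ => (i.insertNth c f : Fin (m + 1) → ℝ)) := by
    intro i c
    refine LipschitzWith.of_dist_le_mul fun f g => ?_
    rw [Fin.dist_insertNth_insertNth]
    simp
  have hfin : ∀ (i : Fin (m + 1)) (c : ℝ), (μH[(m : ℝ)] : Measure (Fin (m + 1) → ℝ))
      ((fun f : Fin m → ℝ => (i.insertNth c f : Fin (m + 1) → ℝ)) '' closedBall 0 R) < ∞ := by
    intro i c
    refine ((hlip i c).hausdorffMeasure_image_le (Nat.cast_nonneg m) _).trans_lt ?_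
    have h := hausdorffMeasure_pi_real (ι := Fin m)
    rw [Fintype.card_fin] at h
    rw [h]
    simpa using (isCompact_closedBall (0 : Fin m → ℝ) R).measure_lt_top
  -- The sup-norm sphere is the boundary of a cube: some coordinate is `±R`, and the others range
  -- over an `m`-dimensional cube.
  have hsub : sphere (0 : Fin (m + 1) → ℝ) R ⊆ ⋃ i : Fin (m + 1),
      ((fun f : Fin m → ℝ => (i.insertNth R f : Fin (m + 1) → ℝ)) '' closedBall 0 R) ∪
      ((fun f : Fin m → ℝ => (i.insertNth (-R) f : Fin (m + 1) → ℝ)) '' closedBall 0 R) := by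
    intro z hz
    rw [mem_sphere_zero_iff_norm] at hz
    have hR : 0 ≤ R := hz ▸ norm_nonneg z
    obtain ⟨i, hi⟩ : ∃ i, ‖z i‖ = R := by
      obtain ⟨i, -, hi⟩ := Finset.exists_max_image Finset.univ (fun i => ‖z i‖)
        Finset.univ_nonempty
      refine ⟨i, le_antisymm (hz ▸ norm_le_pi_norm z i) ?_⟩
      rw [← hz]
      exact (pi_norm_le_iff_of_nonneg (norm_nonneg _)).2 fun j => hi j (Finset.mem_univ j)
    have hmem : i.removeNth z ∈ closedBall (0 : Fin m → ℝ) R := by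
      rw [mem_closedBall_zero_iff, pi_norm_le_iff_of_nonneg hR]
      intro j
      exact hz ▸ norm_le_pi_norm z _
    refine Set.mem_iUnion.2 ⟨i, ?_⟩
    rcases (abs_eq hR).1 hi with h | h
    · exact Or.inl ⟨_, hmem, by rw [← h]; exact Fin.insertNth_self_removeNth i z⟩
    · exact Or.inr ⟨_, hmem, by rw [← h]; exact Fin.insertNth_self_removeNth i z⟩
  refine (measure_mono hsub).trans_lt ((measure_iUnion_le _).trans_lt ?_)
  rw [tsum_fintype]
  exact ENNReal.sum_lt_top.2 fun i _ =>
    (measure_union_le _ _).trans_lt (ENNReal.add_lt_top.2 ⟨hfin i _, hfin i _⟩)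

/-- Moving points outwards along their normals does not decrease distances. -/
theorem IsOuterNormal.dist_le {K : ConvexBody (Euc n)} {x x' v v' : Euc n}
    (h : IsOuterNormal K x v) (h' : IsOuterNormal K x' v') {t t' : ℝ} (ht : 0 ≤ t) (ht' : 0 ≤ t') :
    dist x x' ≤ dist (x + t • v) (x' + t' • v') := by
  rw [dist_eq_norm, dist_eq_norm]
  have h1 : ⟪x', v⟫ ≤ ⟪x, v⟫ := h.2.2 x' h'.1
  have h2 : ⟪x, v'⟫ ≤ ⟪x', v'⟫ := h'.2.2 x h.1
  -- Both brackets are nonnegative by the defining inequality of normals, so this inner product is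
  -- at least `‖x - x'‖ ^ 2`; Cauchy–Schwarz then concludes.
  have hexp : ⟪x + t • v - (x' + t' • v'), x - x'⟫
      = ‖x - x'‖ ^ 2 + t * (⟪x, v⟫ - ⟪x', v⟫) + t' * (⟪x', v'⟫ - ⟪x, v'⟫) := by
    have : x + t • v - (x' + t' • v') = (x - x') + (t • v - t' • v') := by abel
    rw [this, inner_add_left, real_inner_self_eq_norm_sq, inner_sub_left, inner_smul_left,
      inner_smul_left, inner_sub_right, inner_sub_right, real_inner_comm x v, real_inner_comm x' v,
      real_inner_comm x v', real_inner_comm x' v']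
    simp only [conj_trivial]
    ring
  have hle := real_inner_le_norm (x + t • v - (x' + t' • v')) (x - x')
  have h3 := mul_nonneg ht (sub_nonneg.2 h1)
  have h4 := mul_nonneg ht' (sub_nonneg.2 h2)
  by_contra! hlt
  have hpos : 0 < ‖x - x'‖ := (norm_nonneg _).trans_lt hlt
  have := mul_lt_mul_of_pos_right hlt hpos
  nlinarith

theorem exists_norm_ofLp_eq {R : ℝ} {x v : Euc n} (hx : ‖x.ofLp‖ ≤ R) (hv : v ≠ 0) :
    ∃ t : ℝ, 0 ≤ t ∧ ‖(x + t • v).ofLp‖ = R := by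
  have hv' : 0 < ‖v.ofLp‖ := norm_pos_iff.2 fun h => hv (by ext i; simp [h])
  have hR : 0 ≤ R := (norm_nonneg _).trans hx
  have hcont : Continuous fun t : ℝ => ‖(x + t • v).ofLp‖ :=
    ((PiLp.continuous_ofLp 2 _).comp (by fun_prop)).norm
  -- At time `T` the displacement has sup norm `2R`, enough to leave a cube that contains `x`; the
  -- intermediate value theorem finds the crossing.
  set T := (2 * R) / ‖v.ofLp‖
  have hT : 0 ≤ T := by positivity
  have hbig : R ≤ ‖(x + T • v).ofLp‖ := by
    have h1 : ‖(T • v).ofLp‖ = 2 * R := by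
      rw [WithLp.ofLp_smul, norm_smul, Real.norm_of_nonneg hT]
      exact div_mul_cancel₀ _ hv'.ne'
    have h2 := norm_sub_norm_le (T • v).ofLp (-x.ofLp)
    rw [sub_neg_eq_add, norm_neg, h1, add_comm] at h2
    rw [WithLp.ofLp_add]
    linarith
  obtain ⟨t, ht, h⟩ := intermediate_value_Icc hT hcont.continuousOn
    (show R ∈ Set.Icc _ _ from ⟨by simpa using hx, hbig⟩)
  exact ⟨t, ht.1, h⟩

/-- Pushing boundary points along their normals until they hit a large cube never shrinks distances.
The boundary therefore has Hausdorff measure at most that of the cube's surface, up to the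
dimensional factor from comparing Euclidean and sup norms. -/
theorem euclideanHausdorffMeasure_regularBoundary_lt_top (hn : 1 ≤ n) (K : ConvexBody (Euc n)) :
    (μHE[n - 1] : Measure (Euc n)) (regularBoundary K) < ∞ := by
  obtain ⟨m, rfl⟩ : ∃ m, n = m + 1 := ⟨n - 1, by omega⟩
  rw [Nat.add_sub_cancel, Measure.euclideanHausdorffMeasure_def, Measure.smul_apply]
  refine ENNReal.mul_lt_top ENNReal.coe_lt_top ?_
  obtain ⟨R, hR⟩ : ∃ R, ∀ x ∈ K, ‖x.ofLp‖ ≤ R := by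
    obtain ⟨R, hR⟩ := (K.isCompact.image (PiLp.continuous_ofLp 2 _)).isBounded.exists_norm_le
    exact ⟨R, fun x hx => hR _ ⟨x, hx, rfl⟩⟩
  have hex : ∀ x : regularBoundary K, ∃ (v : Euc (m + 1)) (t : ℝ), IsOuterNormal K x v ∧ 0 ≤ t ∧
      ‖((x : Euc (m + 1)) + t • v).ofLp‖ = R := by
    rintro ⟨x, v, hv, -⟩
    obtain ⟨t, ht, h⟩ := exists_norm_ofLp_eq (hR x hv.1) (v := v)
      (norm_ne_zero_iff.1 (by rw [hv.2.1]; exact one_ne_zero))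
    exact ⟨v, t, hv, ht, h⟩
  choose v t hv ht hnorm using hex
  have hanti : AntilipschitzWith 1 fun x : regularBoundary K =>
      (x : Euc (m + 1)) + t x • v x :=
    AntilipschitzWith.of_le_mul_dist fun x y => by
      rw [NNReal.coe_one, one_mul]
      exact (hv x).dist_le (hv y) (ht x) (ht y)
  have hanti' := (PiLp.antilipschitzWith_ofLp 2 fun _ : Fin (m + 1) => ℝ).comp hanti
  have h1 := hanti'.le_hausdorffMeasure_image (Nat.cast_nonneg (α := ℝ) m) Set.univ
  have h2 := (isometry_subtype_coe (s := regularBoundary K)).hausdorffMeasure_image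
    (Or.inl (Nat.cast_nonneg (α := ℝ) m)) Set.univ
  rw [Set.image_univ, Subtype.range_coe] at h2
  rw [h2]
  refine h1.trans_lt (ENNReal.mul_lt_top (ENNReal.rpow_lt_top_of_nonneg (Nat.cast_nonneg _)
    ENNReal.coe_ne_top) ?_)
  refine (measure_mono ?_).trans_lt (hausdorffMeasure_sphere_pi_lt_top m R)
  rintro _ ⟨x, -, rfl⟩
  exact mem_sphere_zero_iff_norm.2 (hnorm x)

theorem isFiniteMeasure_surfaceAreaMeasure (hn : 1 ≤ n) (K : ConvexBody (Euc n)) :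
    IsFiniteMeasure (surfaceAreaMeasure K) := by
  have : IsFiniteMeasure ((μHE[n - 1] : Measure (Euc n)).restrict (regularBoundary K)) :=
    isFiniteMeasure_restrict.2 (euclideanHausdorffMeasure_regularBoundary_lt_top hn K).ne
  exact Measure.isFiniteMeasure_map _ _

/-- The surface area measure is defined on all of `ℝⁿ`, while the bounds on `h_K` are available only
at unit vectors. -/
theorem ae_norm_eq_one_surfaceAreaMeasure (K : ConvexBody (Euc n)) :
    ∀ᵐ θ ∂surfaceAreaMeasure K, ‖θ‖ = 1 := by
  refine (ae_map_iff (aemeasurable_gaussMap K)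
    (measurableSet_eq_fun measurable_norm measurable_const)).2 ?_
  refine (ae_restrict_mem (measurableSet_regularBoundary K)).mono fun x hx => ?_
  exact (Classical.epsilon_spec (p := IsOuterNormal K x) hx.exists).2.1

/-! ### The `L_p` energy as a norm -/

theorem continuous_supportFn (K : ConvexBody (Euc n)) : Continuous (supportFn K) :=
  K.isCompact.continuous_sSup (f := fun v x => ⟪x, v⟫)
    (continuous_snd.inner continuous_fst)

theorem inner_le_supportFn (K : ConvexBody (Euc n)) {x : Euc n} (hx : x ∈ K) (v : Euc n) :
    ⟪x, v⟫ ≤ supportFn K v :=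
  le_csSup (K.isCompact.image (by fun_prop)).bddAbove ⟨x, hx, rfl⟩

/-- A ball around the origin inside `K` gives the bound. It is needed because the exponent `1 - p`
is negative. -/
theorem exists_pos_le_supportFn (K : ConvexBody (Euc n)) (h0 : (0 : Euc n) ∈ interior (K : Set _)) :
    ∃ r : ℝ, 0 < r ∧ ∀ v, ‖v‖ = 1 → r ≤ supportFn K v := by
  obtain ⟨r, hr, h⟩ := nhds_basis_closedBall.mem_iff.1 (mem_interior_iff_mem_nhds.1 h0)
  refine ⟨r, hr, fun v hv => ?_⟩
  have hmem : r • v ∈ K := h (by simp [norm_smul, hv, abs_of_pos hr])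
  simpa [inner_smul_left, real_inner_self_eq_norm_sq, hv] using inner_le_supportFn K hmem v

theorem memLp_inner_mul_rpow_supportFn (hn : 1 ≤ n) {p : ℝ} (hp : 1 < p) (K : ConvexBody (Euc n))
    (h0 : (0 : Euc n) ∈ interior (K : Set _)) (x : Euc n) :
    MemLp (fun θ => ⟪x, θ⟫ * supportFn K θ ^ ((1 - p) / p)) (ENNReal.ofReal p)
      (surfaceAreaMeasure K) := by
  have := isFiniteMeasure_surfaceAreaMeasure hn K
  obtain ⟨r, hr, hle⟩ := exists_pos_le_supportFn K h0
  refine MemLp.of_bound ?_ (‖x‖ * r ^ ((1 - p) / p)) ?_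
  · exact ((by fun_prop : Measurable fun θ : Euc n => ⟪x, θ⟫).mul
      ((continuous_supportFn K).measurable.pow_const _)).aestronglyMeasurable
  · filter_upwards [ae_norm_eq_one_surfaceAreaMeasure K] with θ hθ
    have hs := hle θ hθ
    rw [norm_mul]
    refine mul_le_mul ?_ ?_ (norm_nonneg _) (norm_nonneg _)
    · simpa [hθ] using abs_real_inner_le_norm x θ
    · rw [Real.norm_of_nonneg (Real.rpow_nonneg (hr.le.trans hs) _)]
      exact Real.rpow_le_rpow_of_nonpos hr hs
        (div_nonpos_of_nonpos_of_nonneg (by linarith) (by linarith))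

/-- The `p`-th root of the `L_p` energy is a seminorm. -/
theorem exists_seminorm_eq_lpEnergy_rpow (hn : 1 ≤ n) {p : ℝ} (hp : 1 < p) (K : ConvexBody (Euc n))
    (h0 : (0 : Euc n) ∈ interior (K : Set _)) :
    ∃ N : Seminorm ℝ (Euc n), Continuous N ∧ ∀ x, lpEnergy p K x ^ (1 / p) = N x := by
  have hp0 : 0 < p := by linarith
  have : Fact (1 ≤ ENNReal.ofReal p) := ⟨ENNReal.one_le_ofReal.2 hp.le⟩
  have hL := memLp_inner_mul_rpow_supportFn hn hp K h0
  let G : Euc n →ₗ[ℝ] Lp ℝ (ENNReal.ofReal p) (surfaceAreaMeasure K) :=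
    { toFun := fun x => (hL x).toLp _
      map_add' := fun x y => by
        rw [← MemLp.toLp_add]
        congr 1
        ext θ
        simp [inner_add_left, add_mul]
      map_smul' := fun c x => by
        rw [RingHom.id_apply, ← MemLp.toLp_const_smul]
        congr 1
        ext θ
        simp [inner_smul_left, mul_assoc] }
  refine ⟨(normSeminorm ℝ _).comp G, G.continuous_of_finiteDimensional.norm, fun x => ?_⟩
  change _ = ‖(hL x).toLp _‖
  rw [Lp.norm_toLp, (hL x).eLpNorm_eq_integral_rpow_norm (by simpa using hp0) ENNReal.ofReal_ne_top,
    ENNReal.toReal_ofReal hp0.le, ENNReal.toReal_ofReal (by positivity), one_div, lpEnergy]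
  congr 1
  obtain ⟨r, hr, hle⟩ := exists_pos_le_supportFn K h0
  refine integral_congr_ae ?_
  filter_upwards [ae_norm_eq_one_surfaceAreaMeasure K] with θ hθ
  have hs : 0 ≤ supportFn K θ := hr.le.trans (hle θ hθ)
  rw [norm_mul, Real.mul_rpow (norm_nonneg _) (norm_nonneg _),
    Real.norm_of_nonneg (Real.rpow_nonneg hs _), ← Real.rpow_mul hs, div_mul_cancel₀ _ hp0.ne',
    Real.norm_eq_abs]

theorem lpEnergy_nonneg (p : ℝ) (K : ConvexBody (Euc n))
    (h0 : (0 : Euc n) ∈ interior (K : Set _)) (x : Euc n) : 0 ≤ lpEnergy p K x := by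
  obtain ⟨r, hr, hle⟩ := exists_pos_le_supportFn K h0
  refine integral_nonneg_of_ae ?_
  filter_upwards [ae_norm_eq_one_surfaceAreaMeasure K] with θ hθ
  exact mul_nonneg (Real.rpow_nonneg (abs_nonneg _) _)
    (Real.rpow_nonneg (hr.le.trans (hle θ hθ)) _)

/-! ### The polar body -/

/-- The polar of the Wulff shape of a seminorm is its unit ball. -/
theorem polarSet_wulffShape (N : Seminorm ℝ (Euc n)) :
    polarSet {x | ∀ v : Euc n, ‖v‖ = 1 → ⟪x, v⟫ ≤ N v} = {x | N x ≤ 1} := by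
  ext x
  simp only [polarSet, Set.mem_ofPred_eq]
  rcases eq_or_ne x 0 with rfl | hx
  · simp
  constructor
  · intro h
    -- Hahn–Banach: a functional dominated by `N` and equal to `N` at `x`. Its Riesz vector lies in
    -- the Wulff shape, so testing `x` against it gives `N x ≤ 1`.
    obtain ⟨g, hg, hgN⟩ := exists_extension_of_le_sublinear
      (LinearPMap.mkSpanSingleton (K := ℝ) (L := ℝ) (σ := RingHom.id ℝ) x (N x) hx) N
      (fun c hc y => by rw [map_smul_eq_mul, Real.norm_of_nonneg hc.le]) (map_add_le_add N) (by
        rintro ⟨y, hy⟩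
        obtain ⟨c, rfl⟩ := Submodule.mem_span_singleton.1 hy
        rw [LinearPMap.mkSpanSingleton'_apply, map_smul_eq_mul]
        exact mul_le_mul_of_nonneg_right (le_abs_self c) (apply_nonneg N x))
    have hgx : g x = N x :=
      (hg ⟨x, Submodule.mem_span_singleton_self x⟩).trans (LinearPMap.mkSpanSingleton'_apply_self ..)
    set y := (InnerProductSpace.toDual ℝ (Euc n)).symm (LinearMap.toContinuousLinearMap g) with hy
    have hyg : ∀ z, ⟪y, z⟫ = g z := fun z => by
      rw [hy, InnerProductSpace.toDual_symm_apply]; rfl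
    have := h y fun v _ => (hyg v).trans_le (hgN v)
    rwa [real_inner_comm, hyg, hgx] at this
  · intro h y hy
    have hx' : 0 < ‖x‖ := norm_pos_iff.2 hx
    have := hy (‖x‖⁻¹ • x) (by rw [norm_smul, norm_inv, norm_norm, inv_mul_cancel₀ hx'.ne'])
    rw [inner_smul_right, map_smul_eq_mul, norm_inv, norm_norm] at this
    rw [real_inner_comm]
    exact (le_of_mul_le_mul_left this (inv_pos.2 hx')).trans h

theorem ballVol_pos {r : ℝ} (hr : 0 ≤ r) : 0 < ballVol r :=
  div_pos (Real.rpow_pos_of_pos Real.pi_pos _) (Real.Gamma_pos_of_pos (by positivity))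

theorem lpConst_pos {q p : ℝ} (hq : 0 ≤ q) (hp : 1 ≤ p) : 0 < lpConst q p :=
  div_pos (ballVol_pos (by linarith)) (mul_pos (mul_pos (ballVol_pos zero_le_two) (ballVol_pos hq))
    (ballVol_pos (by linarith)))

theorem volume_seminorm_ball_smul (N : Seminorm ℝ (Euc n)) {a : ℝ} (ha : 0 < a) :
    volume {x | a * N x ≤ 1} = ENNReal.ofReal (a⁻¹ ^ n) * volume {x | N x ≤ 1} := by
  have h := Measure.addHaar_preimage_smul (volume : Measure (Euc n)) ha.ne' {x | N x ≤ 1}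
  rw [finrank_euclideanSpace_fin] at h
  rw [inv_pow, ← abs_of_pos (inv_pos.2 (pow_pos ha n)), ← h]
  congr 1
  ext x
  simp [map_smul_eq_mul, abs_of_pos ha]

theorem volume_polarLpProjectionBody (hn : 2 ≤ n) {p : ℝ} (hp : 1 < p) (K : ConvexBody (Euc n))
    (h0 : (0 : Euc n) ∈ interior (K : Set _)) (N : Seminorm ℝ (Euc n))
    (hN : ∀ x, lpEnergy p K x ^ (1 / p) = N x) :
    volume (polarLpProjectionBody p K) = ENNReal.ofReal
      (((1 / (n * ballVol n * lpConst ((n : ℝ) - 2) p)) ^ (1 / p))⁻¹ ^ n)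
        * volume {x | N x ≤ 1} := by
  have hn2 : (2 : ℝ) ≤ n := by exact_mod_cast hn
  have ha : 0 < 1 / (n * ballVol n * lpConst ((n : ℝ) - 2) p) :=
    one_div_pos.2 (mul_pos (mul_pos (by linarith) (ballVol_pos (Nat.cast_nonneg n)))
      (lpConst_pos (by linarith) hp.le))
  have hb := Real.rpow_pos_of_pos ha (1 / p)
  rw [← volume_seminorm_ball_smul N hb]
  set b : ℝ := (1 / (n * ballVol n * lpConst ((n : ℝ) - 2) p)) ^ (1 / p)
  let c : NNReal := ⟨b, hb.le⟩
  have hs : ∀ v, lpProjectionSupport p K v = (c • N) v := fun v => by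
    rw [lpProjectionSupport, Real.mul_rpow ha.le (lpEnergy_nonneg p K h0 v), hN]
    rfl
  have := polarSet_wulffShape (c • N)
  rw [polarLpProjectionBody, lpProjectionBody]
  simp_rw [hs]
  exact congrArg volume this

/-! ### Splitting off a line -/

/-- The product `ℝ × V` carries the sup norm, so the isometry is seen only on `WithLp 2 (ℝ × V)`;
the passage there preserves volume. -/
theorem measurePreserving_prod_of_norm_sq {V F : Type*}
    [NormedAddCommGroup V] [InnerProductSpace ℝ V] [FiniteDimensional ℝ V] [MeasurableSpace V]
    [BorelSpace V] [NormedAddCommGroup F] [InnerProductSpace ℝ F] [FiniteDimensional ℝ F]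
    [MeasurableSpace F] [BorelSpace F] (L : ℝ × V →ₗ[ℝ] F)
    (hL : ∀ t y, ‖L (t, y)‖ ^ 2 = t ^ 2 + ‖y‖ ^ 2) (hdim : finrank ℝ F = finrank ℝ V + 1) :
    MeasurePreserving L := by
  let l : WithLp 2 (ℝ × V) →ₗᵢ[ℝ] F :=
    ⟨L ∘ₗ (WithLp.linearEquiv 2 ℝ (ℝ × V) : WithLp 2 (ℝ × V) →ₗ[ℝ] ℝ × V), fun x => by
      have h1 : ‖x‖ ^ 2 = ‖x.fst‖ ^ 2 + ‖x.snd‖ ^ 2 := WithLp.prod_norm_sq_eq_of_L2 x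
      rw [Real.norm_eq_abs, sq_abs] at h1
      exact (sq_eq_sq₀ (norm_nonneg _) (norm_nonneg _)).1 ((hL x.fst x.snd).trans h1.symm)⟩
  have hfin : finrank ℝ (WithLp 2 (ℝ × V)) = finrank ℝ F := by
    rw [(WithLp.linearEquiv 2 ℝ (ℝ × V)).finrank_eq, finrank_prod, finrank_self, hdim, add_comm]
  exact (l.toLinearIsometryEquiv hfin).measurePreserving.comp (WithLp.volume_preserving_toLp ℝ V)

theorem norm_smul_add_smul_sq {u w : Euc n} (hu : ‖u‖ = 1) (hw : ‖w‖ = 1) (huw : ⟪u, w⟫ = 0)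
    (s t : ℝ) : ‖s • u + t • w‖ ^ 2 = s ^ 2 + t ^ 2 := by
  rw [norm_add_sq_real, inner_smul_left, inner_smul_right, huw, norm_smul, norm_smul, hu, hw]
  simp

theorem inner_perpSphere (u : UnitSphere n) (w : PerpSphere u) :
    ⟪(u : Euc n), ((w : perp u) : Euc n)⟫ = 0 :=
  Submodule.mem_orthogonal_singleton_iff_inner_right.1 (w : perp u).2

theorem norm_perpSphere {u : UnitSphere n} (w : PerpSphere u) : ‖((w : perp u) : Euc n)‖ = 1 :=
  norm_eq_of_mem_sphere w

theorem norm_unitSphere (u : UnitSphere n) : ‖(u : Euc n)‖ = 1 := norm_eq_of_mem_sphere u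

theorem smul_add_smul_mem_orthogonal (u : UnitSphere n) (w : PerpSphere u) (s t : ℝ) :
    s • (u : Euc n) + t • ((w : perp u) : Euc n) ∈ (Gr.ofNormal u w).spaceᗮ :=
  (Submodule.mem_orthogonal' _ _).2 fun z hz => by
    obtain ⟨h1, h2⟩ := (mem_ofNormal u w z).1 hz
    simp [inner_add_left, inner_smul_left, h1, h2]

theorem eq_smul_add_smul_of_mem_orthogonal (u : UnitSphere n) (w : PerpSphere u) {z : Euc n}
    (hz : z ∈ (Gr.ofNormal u w).spaceᗮ) :
    z = ⟪(u : Euc n), z⟫ • (u : Euc n) + ⟪((w : perp u) : Euc n), z⟫ • ((w : perp u) : Euc n) := by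
  have h := Submodule.starProjection_apply_eq_zero_iff (K := (Gr.ofNormal u w).space) |>.2 hz
  have h' : (Gr.ofNormal u w).proj z = 0 := h
  rw [proj_ofNormal] at h'
  exact sub_eq_zero.1 ((sub_sub _ _ _).symm.trans h')

theorem finrank_orthogonal_ofNormal (hn : 2 ≤ n) (u : UnitSphere n) (w : PerpSphere u) :
    finrank ℝ (Gr.ofNormal u w).spaceᗮ = 2 := by
  have := Submodule.finrank_add_finrank_orthogonal (Gr.ofNormal u w).space
  rw [(Gr.ofNormal u w).finrank_eq, finrank_euclideanSpace_fin] at this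
  omega

/-- Coordinates in the plane spanned by `u` and `w`. -/
def planeMap (u : UnitSphere n) (w : PerpSphere u) : ℝ × ℝ →ₗ[ℝ] (Gr.ofNormal u w).spaceᗮ :=
  LinearMap.codRestrict _
    ((LinearMap.fst ℝ ℝ ℝ).smulRight (u : Euc n) +
      (LinearMap.snd ℝ ℝ ℝ).smulRight ((w : perp u) : Euc n))
    fun a => smul_add_smul_mem_orthogonal u w a.1 a.2

theorem coe_planeMap (u : UnitSphere n) (w : PerpSphere u) (a : ℝ × ℝ) :
    (planeMap u w a : Euc n) = a.1 • (u : Euc n) + a.2 • ((w : perp u) : Euc n) := rfl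

theorem measurePreserving_planeMap (hn : 2 ≤ n) (u : UnitSphere n) (w : PerpSphere u) :
    MeasurePreserving (planeMap u w) :=
  measurePreserving_prod_of_norm_sq _ (fun s t => by
    rw [Submodule.coe_norm, coe_planeMap, norm_smul_add_smul_sq (norm_unitSphere u)
      (norm_perpSphere w) (inner_perpSphere u w), Real.norm_eq_abs, sq_abs])
    (by rw [finrank_orthogonal_ofNormal hn, finrank_self])

/-- The map `(t, y) ↦ y - t u` from `ℝ × u^⊥` to `ℝⁿ`. -/
def cylinderMap (u : UnitSphere n) : ℝ × perp u →ₗ[ℝ] Euc n :=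
  (perp u).subtype ∘ₗ LinearMap.snd ℝ ℝ (perp u)
    - (LinearMap.fst ℝ ℝ (perp u)).smulRight (u : Euc n)

theorem cylinderMap_apply (u : UnitSphere n) (t : ℝ) (y : perp u) :
    cylinderMap u (t, y) = (y : Euc n) - t • (u : Euc n) := rfl

theorem measurePreserving_cylinderMap (hn : 1 ≤ n) (u : UnitSphere n) :
    MeasurePreserving (cylinderMap u) :=
  measurePreserving_prod_of_norm_sq _ (fun t y => by
    have h : ⟪(y : Euc n), (u : Euc n)⟫ = 0 := by
      rw [real_inner_comm]
      exact Submodule.mem_orthogonal_singleton_iff_inner_right.1 y.2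
    rw [cylinderMap_apply, norm_sub_sq_real, inner_smul_right, h, norm_smul, norm_unitSphere,
      Real.norm_eq_abs, mul_one, sq_abs, Submodule.coe_norm]
    ring)
    (by rw [finrank_perp, finrank_euclideanSpace_fin]; omega)

/-! ### Wedge projections in the plane of `u` and `w` -/

/-- In the plane `E^⊥` the vector `s w - t u` is orthogonal to `x` and as long as `x`, so it equals
`±‖x‖ v(E, x)`. Homogeneity of `N` absorbs the length, evenness the choice of sign. -/
theorem wedgeProj_ofNormal {p : ℝ} {K : ConvexBody (Euc n)} {N : Seminorm ℝ (Euc n)}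
    (hN : ∀ x, lpEnergy p K x ^ (1 / p) = N x) (u : UnitSphere n) (w : PerpSphere u) (s t : ℝ) :
    wedgeProj p K (Gr.ofNormal u w).space (s • (u : Euc n) + t • ((w : perp u) : Euc n))
      = N (s • ((w : perp u) : Euc n) - t • (u : Euc n)) := by
  have hmem := smul_add_smul_mem_orthogonal u w s t
  have hsq := norm_smul_add_smul_sq (norm_unitSphere u) (norm_perpSphere w)
    (inner_perpSphere u w) s t
  rw [wedgeProj, hN, Submodule.starProjection_eq_self_iff.2 hmem]
  set x := s • (u : Euc n) + t • ((w : perp u) : Euc n) with hx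
  rcases eq_or_ne x 0 with h0 | h0
  · rw [h0, norm_zero, zero_pow two_ne_zero] at hsq
    have hs : s = 0 := by nlinarith [sq_nonneg s, sq_nonneg t]
    have ht : t = 0 := by nlinarith [sq_nonneg s, sq_nonneg t]
    simp [h0, hs, ht]
  have hr : 0 < ‖x‖ := norm_pos_iff.2 h0
  have hu := norm_unitSphere u
  have hw := norm_perpSphere w
  have huw := inner_perpSphere u w
  have hwu : ⟪((w : perp u) : Euc n), (u : Euc n)⟫ = 0 := by rw [real_inner_comm]; exact huw
  have hiff : ∀ v, v ∈ ((Gr.ofNormal u w).space ⊔ ℝ ∙ x)ᗮ ↔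
      v ∈ (Gr.ofNormal u w).spaceᗮ ∧ ⟪x, v⟫ = 0 := fun v => by
    rw [← Submodule.inf_orthogonal, Submodule.mem_inf,
      Submodule.mem_orthogonal_singleton_iff_inner_right]
  have hex : ∃ v, ‖v‖ = 1 ∧ v ∈ ((Gr.ofNormal u w).space ⊔ ℝ ∙ x)ᗮ := by
    refine ⟨‖x‖⁻¹ • ((-t) • (u : Euc n) + s • ((w : perp u) : Euc n)), ?_, ?_⟩
    · have h := norm_smul_add_smul_sq hu hw huw (-t) s
      rw [neg_sq, add_comm (t ^ 2), ← hsq, sq_eq_sq₀ (norm_nonneg _) (norm_nonneg _)] at h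
      rw [norm_smul, h, norm_inv, norm_norm, inv_mul_cancel₀ hr.ne']
    · refine (hiff _).2 ⟨Submodule.smul_mem _ _ (smul_add_smul_mem_orthogonal u w _ _), ?_⟩
      rw [hx]
      simp [inner_smul_right, inner_add_left, inner_add_right, inner_smul_left, huw, hwu, hu, hw]
      ring
  obtain ⟨hv1, hv2⟩ : ‖unitNormal (Gr.ofNormal u w).space x‖ = 1 ∧
      unitNormal (Gr.ofNormal u w).space x ∈ ((Gr.ofNormal u w).space ⊔ ℝ ∙ x)ᗮ :=
    Classical.epsilon_spec hex
  set v := unitNormal (Gr.ofNormal u w).space x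
  obtain ⟨hvE, hvx⟩ := (hiff v).1 hv2
  have hv := eq_smul_add_smul_of_mem_orthogonal u w hvE
  set α := ⟪(u : Euc n), v⟫
  set β := ⟪((w : perp u) : Euc n), v⟫
  have hαβ : α ^ 2 + β ^ 2 = 1 := by
    rw [← norm_smul_add_smul_sq hu hw huw, ← hv, hv1, one_pow]
  have horth : s * α + t * β = 0 := by
    rw [← hvx, hx, inner_add_left, inner_smul_left, inner_smul_left]
    rfl
  -- `k` is the inner product of `v` with `s w - t u`, hence `±‖x‖`; working with `k` avoids a case
  -- split on the sign.
  set k := s * β - t * α with hk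
  have hk2 : k ^ 2 = ‖x‖ ^ 2 := by
    rw [hsq, hk]
    linear_combination (s ^ 2 + t ^ 2) * hαβ - (s * α + t * β) * horth
  have hkv : ‖x‖ ^ 2 • v = k • (s • ((w : perp u) : Euc n) - t • (u : Euc n)) := by
    rw [hv, hsq, smul_sub, smul_add, smul_smul, smul_smul, smul_smul, smul_smul, add_comm,
      sub_eq_add_neg, ← neg_smul]
    congr 2
    · rw [hk]; linear_combination t * horth
    · rw [hk]; linear_combination s * horth
  have hNk := congrArg N hkv
  rw [map_smul_eq_mul, map_smul_eq_mul, Real.norm_eq_abs, Real.norm_eq_abs,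
    (sq_eq_sq_iff_abs_eq_abs k ‖x‖).1 hk2, abs_of_pos hr, abs_of_nonneg (sq_nonneg _), sq,
    mul_assoc] at hNk
  exact mul_left_cancel₀ hr.ne' hNk

/-! ### The Rolodex and its sections -/

/-- Parametrisation of the bundle `V_{n-1,u}` by normals and coordinates. -/
def Bundle.ofNormal (u : UnitSphere n) (q : PerpSphere u × (ℝ × ℝ)) : Bundle u :=
  ⟨Gr.ofNormal u q.1, planeMap u q.1 q.2, (planeMap u q.1 q.2).2⟩

theorem Bundle.continuous_ofNormal (u : UnitSphere n) : Continuous (Bundle.ofNormal u) := by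
  refine (isInducing_toProd u).continuous_iff.2 ?_
  change Continuous fun q : PerpSphere u × (ℝ × ℝ) =>
    (Gr.ofNormal u q.1, q.2.1 • (u : Euc n) + q.2.2 • ((q.1 : perp u) : Euc n))
  have := LpRolodex.continuous_ofNormal u
  fun_prop

theorem Bundle.ofNormal_surjective (hn : 2 ≤ n) (u : UnitSphere n) :
    Function.Surjective (Bundle.ofNormal u) := by
  rintro ⟨E, x, hx⟩
  obtain ⟨w, rfl⟩ := LpRolodex.ofNormal_surjective hn u E
  exact ⟨(w, _, _), Bundle.ext rfl (eq_smul_add_smul_of_mem_orthogonal u w hx).symm⟩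

theorem Bundle.toProd_injective (u : UnitSphere n) :
    Function.Injective (Bundle.toProd (u := u)) := fun _ _ h =>
  Bundle.ext (congrArg Prod.fst h) (congrArg Prod.snd h)

instance (u : UnitSphere n) : T2Space (Bundle u) :=
  .of_injective_continuous (Bundle.toProd_injective u) (isInducing_toProd u).continuous

instance (u : UnitSphere n) : SecondCountableTopology (Bundle u) :=
  (isInducing_toProd u).secondCountableTopology

theorem ofNormal_mem_rolodex {p : ℝ} {K : ConvexBody (Euc n)} {N : Seminorm ℝ (Euc n)}
    (hN : ∀ x, lpEnergy p K x ^ (1 / p) = N x) (u : UnitSphere n)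
    (q : PerpSphere u × (ℝ × ℝ)) : Bundle.ofNormal u q ∈ rolodex p K u ↔
      N (q.2.1 • ((q.1 : perp u) : Euc n) - q.2.2 • (u : Euc n)) ≤ 1 := by
  rw [← wedgeProj_ofNormal hN]
  exact and_iff_right (planeMap u q.1 q.2).2

/-- Measurability descends along the surjective parametrisation `Bundle.ofNormal`, under which the
Rolodex becomes a closed set. -/
theorem measurableSet_rolodex (hn : 2 ≤ n) {p : ℝ} {K : ConvexBody (Euc n)}
    {N : Seminorm ℝ (Euc n)} (hNc : Continuous N)
    (hN : ∀ x, lpEnergy p K x ^ (1 / p) = N x) (u : UnitSphere n) :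
    MeasurableSet (rolodex p K u) := by
  rw [← (Bundle.continuous_ofNormal u).measurable.measurableSet_preimage_iff_of_surjective
    (Bundle.ofNormal_surjective hn u)]
  have : Bundle.ofNormal u ⁻¹' rolodex p K u = {q : PerpSphere u × (ℝ × ℝ) |
      N (q.2.1 • ((q.1 : perp u) : Euc n) - q.2.2 • (u : Euc n)) ≤ 1} :=
    Set.ext fun q => ofNormal_mem_rolodex hN u q
  rw [this]
  exact (isClosed_le (hNc.comp (by fun_prop)) continuous_const).measurableSet

/-- The line `E^⊥ ∩ u^⊥` is spanned by the normal `w` of `E` in `u^⊥`. -/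
def lineEquiv (u : UnitSphere n) (w : PerpSphere u) :
    ℝ ≃ₗᵢ[ℝ] ↥((Gr.ofNormal u w).spaceᗮ ⊓ perp u) :=
  LinearIsometryEquiv.ofSurjective
    ⟨LinearMap.codRestrict _ (LinearMap.toSpanSingleton ℝ (Euc n) ((w : perp u) : Euc n))
      fun t => ⟨by simpa using smul_add_smul_mem_orthogonal u w 0 t,
        Submodule.smul_mem _ _ (w : perp u).2⟩, fun t => by
      change ‖t • ((w : perp u) : Euc n)‖ = ‖t‖
      rw [norm_smul, norm_perpSphere, mul_one]⟩
    (by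
      rintro ⟨y, hy, hyu⟩
      refine ⟨⟪((w : perp u) : Euc n), y⟫, Subtype.ext ?_⟩
      have h := eq_smul_add_smul_of_mem_orthogonal u w hy
      rw [Submodule.mem_orthogonal_singleton_iff_inner_right.1 hyu, zero_smul, zero_add] at h
      exact h.symm)

theorem coe_lineEquiv (u : UnitSphere n) (w : PerpSphere u) (t : ℝ) :
    (lineEquiv u w t : Euc n) = t • ((w : perp u) : Euc n) := rfl

theorem volume_lpSection {p : ℝ} {K : ConvexBody (Euc n)} {N : Seminorm ℝ (Euc n)}
    (hN : ∀ x, lpEnergy p K x ^ (1 / p) = N x) (u : UnitSphere n)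
    (w : PerpSphere u) (s : ℝ) : volume (lpSection p K u (Gr.ofNormal u w) s)
      = volume {t : ℝ | N (s • ((w : perp u) : Euc n) - t • (u : Euc n)) ≤ 1} := by
  rw [← (lineEquiv u w).measurePreserving.measure_preimage_emb
    (lineEquiv u w).toMeasurableEquiv.measurableEmbedding]
  congr 1
  ext t
  rw [Set.mem_ofPred_eq, ← wedgeProj_ofNormal hN, add_comm, ← coe_lineEquiv]
  rfl

theorem lintegral_fiber_rolodex (hn : 2 ≤ n) {p : ℝ} {K : ConvexBody (Euc n)}
    {N : Seminorm ℝ (Euc n)} (hNc : Continuous N) (hN : ∀ x, lpEnergy p K x ^ (1 / p) = N x)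
    (u : UnitSphere n) (E : Gr u) :
    ∫⁻ x : E.spaceᗮ, ({x : E.spaceᗮ | (⟨E, x, x.2⟩ : Bundle u) ∈ rolodex p K u}).indicator
        (fun x => ENNReal.ofReal (|⟪(x : Euc n), (u : Euc n)⟫| ^ (n - 2))) x
      = ∫⁻ s : ℝ, ENNReal.ofReal (|s| ^ (n - 2)) * volume (lpSection p K u E s) := by
  obtain ⟨w, rfl⟩ := ofNormal_surjective hn u E
  have hm := measurable_fiberIncl (Gr.ofNormal u w) (measurableSet_rolodex hn hNc hN u)
  have hmeas : Measurable (({x : (Gr.ofNormal u w).spaceᗮ |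
      (⟨Gr.ofNormal u w, x, x.2⟩ : Bundle u) ∈ rolodex p K u}).indicator
        (fun x => ENNReal.ofReal (|⟪(x : Euc n), (u : Euc n)⟫| ^ (n - 2)))) :=
    Measurable.indicator (by fun_prop) hm
  have hpm := measurePreserving_planeMap hn u w
  rw [← hpm.lintegral_comp hmeas, Measure.volume_eq_prod]
  -- In the coordinates `(s, t)` the density depends on `s = ⟪x, u⟫` alone, so the inner integral is
  -- a constant times the length of a section.
  refine (lintegral_prod _ (hmeas.comp hpm.measurable).aemeasurable).trans
    (lintegral_congr fun s => ?_)
  simp only [Function.comp_apply]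
  rw [volume_lpSection hN, ← lintegral_indicator_const]
  · refine lintegral_congr fun t => ?_
    have h1 : ⟪(planeMap u w (s, t) : Euc n), (u : Euc n)⟫ = s := by
      rw [coe_planeMap, real_inner_comm, inner_add_right, inner_smul_right, inner_smul_right,
        inner_perpSphere, real_inner_self_eq_norm_sq, norm_unitSphere]
      simp
    have h2 : planeMap u w (s, t) ∈ {x : (Gr.ofNormal u w).spaceᗮ |
        (⟨Gr.ofNormal u w, x, x.2⟩ : Bundle u) ∈ rolodex p K u} ↔
        t ∈ {t : ℝ | N (s • ((w : perp u) : Euc n) - t • (u : Euc n)) ≤ 1} :=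
      ofNormal_mem_rolodex hN u (w, s, t)
    by_cases h : t ∈ {t : ℝ | N (s • ((w : perp u) : Euc n) - t • (u : Euc n)) ≤ 1}
    · rw [Set.indicator_of_mem h, Set.indicator_of_mem (h2.2 h), h1]
    · rw [Set.indicator_of_notMem h, Set.indicator_of_notMem (mt h2.1 h)]
  · exact (isClosed_le (hNc.comp (by fun_prop)) continuous_const).measurableSet

/-! ### Cylindrical coordinates -/

/-- Polar coordinates on the complement of the origin, which is a null set because `V` is
nontrivial. -/
theorem lintegral_eq_lintegral_toSphere {V : Type*} [NormedAddCommGroup V] [NormedSpace ℝ V]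
    [FiniteDimensional ℝ V] [Nontrivial V] [MeasurableSpace V] [BorelSpace V] (μ : Measure V)
    [μ.IsAddHaarMeasure] {g : V → ℝ≥0∞} (hg : Measurable g) :
    ∫⁻ y, g y ∂μ = ∫⁻ w : sphere (0 : V) 1, (∫⁻ r in Set.Ioi (0 : ℝ),
      ENNReal.ofReal (r ^ (finrank ℝ V - 1)) * g (r • (w : V))) ∂μ.toSphere := by
  have h := μ.measurePreserving_homeomorphUnitSphereProd.symm
    (homeomorphUnitSphereProd V).toMeasurableEquiv
  have hG : Measurable fun y : ({0}ᶜ : Set V) => g y := hg.comp measurable_subtype_coe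
  rw [← lintegral_add_compl g (measurableSet_singleton (0 : V)), Measure.restrict_singleton,
    measure_singleton, zero_smul, lintegral_zero_measure, zero_add,
    ← lintegral_subtype_comap (measurableSet_singleton (0 : V)).compl,
    ← h.lintegral_comp hG]
  refine (lintegral_prod _ (hG.comp h.measurable).aemeasurable).trans
    (lintegral_congr fun w => ?_)
  rw [Measure.volumeIoiPow, ← lintegral_subtype_comap measurableSet_Ioi
      (fun r => ENNReal.ofReal (r ^ (finrank ℝ V - 1)) * g (r • (w : V)))]
  exact lintegral_withDensity_eq_lintegral_mul _ (by fun_prop)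
    ((hG.comp h.measurable).comp measurable_prodMk_left)

theorem lintegral_eq_two_mul_of_even {f : ℝ → ℝ≥0∞} (hf : ∀ s, f (-s) = f s) :
    ∫⁻ s, f s = 2 * ∫⁻ s in Set.Ioi (0 : ℝ), f s := by
  have h1 : ∫⁻ s in Set.Iio (0 : ℝ), f s = ∫⁻ s in Set.Ioi (0 : ℝ), f s := by
    have := (Measure.measurePreserving_neg (volume : Measure ℝ)).setLIntegral_comp_preimage_emb
      (MeasurableEquiv.neg ℝ).measurableEmbedding f (Set.Ioi 0)
    simpa [hf] using this
  rw [← lintegral_add_compl f measurableSet_Ioi (A := Set.Ioi (0 : ℝ)), Set.compl_Ioi,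
    setLIntegral_congr Iio_ae_eq_Iic.symm, h1, two_mul]

theorem two_mul_volume_seminorm_ball (hn : 2 ≤ n) {N : Seminorm ℝ (Euc n)} (hNc : Continuous N)
    (u : UnitSphere n) :
    2 * volume {x | N x ≤ 1} = ∫⁻ w : PerpSphere u, (∫⁻ s : ℝ, ENNReal.ofReal (|s| ^ (n - 2)) *
      volume {t : ℝ | N (s • ((w : perp u) : Euc n) - t • (u : Euc n)) ≤ 1})
        ∂(volume : Measure (perp u)).toSphere := by
  have : Nontrivial (perp u) := nontrivial_of_finrank_pos (R := ℝ) (by rw [finrank_perp]; omega)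
  have hball : MeasurableSet {x | N x ≤ 1} := (isClosed_le hNc continuous_const).measurableSet
  have hpm := measurePreserving_cylinderMap (by omega) u
  have hpre := hpm.measurable hball
  -- The length of the chord parallel to `u` over `y`; it is even in `y` since `{N ≤ 1}` is
  -- centrally symmetric.
  let g : perp u → ℝ≥0∞ := fun y => volume {t : ℝ | N ((y : Euc n) - t • (u : Euc n)) ≤ 1}
  have hg : Measurable g := measurable_measure_prodMk_right hpre
  have hodd : ∀ y, g (-y) = g y := fun y => by
    refine ((Measure.measurePreserving_neg (volume : Measure ℝ)).measure_preimage_emb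
      (MeasurableEquiv.neg ℝ).measurableEmbedding _).symm.trans
      (congrArg volume (Set.ext fun t => ?_))
    have : ((-y : perp u) : Euc n) - (-t) • (u : Euc n) = -((y : Euc n) - t • (u : Euc n)) := by
      rw [Submodule.coe_neg, neg_smul]; abel
    change N (((-y : perp u) : Euc n) - (-t) • (u : Euc n)) ≤ 1 ↔ _
    rw [this, map_neg_eq_map]
    rfl
  have hvol : volume {x | N x ≤ 1} = ∫⁻ y, g y := by
    rw [← hpm.measure_preimage hball.nullMeasurableSet, Measure.volume_eq_prod,
      Measure.prod_apply_symm hpre]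
    rfl
  rw [hvol, lintegral_eq_lintegral_toSphere _ hg, finrank_perp, ← lintegral_const_mul' _ _ (by simp)]
  refine lintegral_congr fun w => ?_
  rw [lintegral_eq_two_mul_of_even (f := fun s => ENNReal.ofReal (|s| ^ (n - 2)) *
      volume {t : ℝ | N (s • ((w : perp u) : Euc n) - t • (u : Euc n)) ≤ 1})]
  · congr 1
    refine setLIntegral_congr_fun measurableSet_Ioi fun s hs => ?_
    simp only [abs_of_pos (Set.mem_Ioi.1 hs)]
    rfl
  · intro s
    have := hodd (s • (w : perp u))
    rw [← neg_smul] at this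
    rw [abs_neg]
    exact congrArg _ this

theorem measurable_lintegral_lpSection (hn : 2 ≤ n) {p : ℝ} {K : ConvexBody (Euc n)}
    {N : Seminorm ℝ (Euc n)} (hNc : Continuous N) (hN : ∀ x, lpEnergy p K x ^ (1 / p) = N x)
    (u : UnitSphere n) : Measurable fun E : Gr u =>
      ∫⁻ s : ℝ, ENNReal.ofReal (|s| ^ (n - 2)) * volume (lpSection p K u E s) := by
  rw [← (continuous_ofNormal u).measurable.measurable_comp_iff_of_surjective
    (ofNormal_surjective hn u)]
  simp only [Function.comp_def, volume_lpSection hN]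
  have hc : Measurable fun q : PerpSphere u × ℝ =>
      volume {t : ℝ | N (q.2 • ((q.1 : perp u) : Euc n) - t • (u : Euc n)) ≤ 1} := by
    have hset : MeasurableSet {q : (PerpSphere u × ℝ) × ℝ |
        N (q.1.2 • ((q.1.1 : perp u) : Euc n) - q.2 • (u : Euc n)) ≤ 1} :=
      (isClosed_le (hNc.comp (by fun_prop)) continuous_const).measurableSet
    exact measurable_measure_prodMk_left hset
  exact Measurable.lintegral_prod_right' (f := fun q : PerpSphere u × ℝ =>
    ENNReal.ofReal (|q.2| ^ (n - 2)) *
      volume {t : ℝ | N (q.2 • ((q.1 : perp u) : Euc n) - t • (u : Euc n)) ≤ 1})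
    (Measurable.mul (by fun_prop) hc)

/-- The total mass of the unit sphere of `u^⊥`. -/
def perpSphereMass (n : ℕ) : ℝ :=
  (n - 1 : ℕ) * (√Real.pi ^ (n - 1) / Real.Gamma ((n - 1 : ℕ) / 2 + 1))

/-- This makes the final constant independent of `u`. -/
theorem toSphere_perp_univ (hn : 2 ≤ n) (u : UnitSphere n) :
    (volume : Measure (perp u)).toSphere Set.univ = ENNReal.ofReal (perpSphereMass n) := by
  have : Nontrivial (perp u) := nontrivial_of_finrank_pos (R := ℝ) (by rw [finrank_perp]; omega)
  rw [Measure.toSphere_apply_univ, InnerProductSpace.volume_ball, finrank_perp, perpSphereMass,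
    ENNReal.ofReal_mul (Nat.cast_nonneg _), ENNReal.ofReal_natCast, ENNReal.ofReal_one, one_pow,
    one_mul]

theorem perpSphereMass_pos (hn : 2 ≤ n) : 0 < perpSphereMass n := by
  have h1 : (0 : ℝ) < (n - 1 : ℕ) := by exact_mod_cast (by omega : 0 < n - 1)
  exact mul_pos h1 (div_pos (pow_pos (Real.sqrt_pos.2 Real.pi_pos) _)
    (Real.Gamma_pos_of_pos (by positivity)))

theorem volume_seminorm_ball_eq (hn : 2 ≤ n) {p : ℝ} {K : ConvexBody (Euc n)}
    {N : Seminorm ℝ (Euc n)} (hNc : Continuous N) (hN : ∀ x, lpEnergy p K x ^ (1 / p) = N x)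
    (u : UnitSphere n) :
    volume {x | N x ≤ 1} = ENNReal.ofReal (perpSphereMass n / 2) *
      ∫⁻ E : Gr u, (∫⁻ s : ℝ, ENNReal.ofReal (|s| ^ (n - 2)) * volume (lpSection p K u E s))
        ∂(grMeasure u) := by
  have hM := perpSphereMass_pos hn
  -- The mass undoes the normalisation of the sphere, and the half undoes the doubling from letting
  -- `s` run over all of `ℝ`.
  have hc : ENNReal.ofReal (perpSphereMass n / 2) *
      ((ENNReal.ofReal (perpSphereMass n))⁻¹ * 2) = 1 := by
    rw [← ENNReal.ofReal_inv_of_pos hM, ← ENNReal.ofReal_ofNat, ← ENNReal.ofReal_mul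
      (by positivity), ← ENNReal.ofReal_mul (by positivity), ← ENNReal.ofReal_one]
    congr 1
    field_simp
  rw [grMeasure, lintegral_map (measurable_lintegral_lpSection hn hNc hN u)
    (continuous_ofNormal u).measurable]
  simp only [volume_lpSection hN]
  rw [uniformSphere, lintegral_smul_measure, ← two_mul_volume_seminorm_ball hn hNc u,
    toSphere_perp_univ hn, smul_eq_mul, ← mul_assoc (_⁻¹), ← mul_assoc, hc, one_mul]

end LpRolodex

end

theorem mainTheorem7 (n : ℕ) (hn : 2 ≤ n) (p : ℝ) (hp : 1 < p) :
    ∃ c : ℝ, 0 < c ∧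
      ∀ (K : ConvexBody (EuclideanSpace ℝ (Fin n)))
        (_ : (0 : EuclideanSpace ℝ (Fin n)) ∈ interior (K : Set (EuclideanSpace ℝ (Fin n))))
        (u : Metric.sphere (0 : EuclideanSpace ℝ (Fin n)) 1),
        MeasureTheory.volume (LpRolodex.polarLpProjectionBody p K)
            = ENNReal.ofReal c * LpRolodex.rolodexMeasure u (LpRolodex.rolodex p K u) ∧
        MeasureTheory.volume (LpRolodex.polarLpProjectionBody p K)
            = ENNReal.ofReal c *
                ∫⁻ E : LpRolodex.Gr u,
                  (∫⁻ s : ℝ, ENNReal.ofReal (|s| ^ (n - 2)) *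
                    MeasureTheory.volume (LpRolodex.lpSection p K u E s))
                  ∂(LpRolodex.grMeasure u) := by
  have hn2 : (2 : ℝ) ≤ n := by exact_mod_cast hn
  have hM := LpRolodex.perpSphereMass_pos hn
  have ha : 0 < 1 / (n * LpRolodex.ballVol n * LpRolodex.lpConst ((n : ℝ) - 2) p) :=
    one_div_pos.2 (mul_pos (mul_pos (by linarith) (LpRolodex.ballVol_pos (Nat.cast_nonneg n)))
      (LpRolodex.lpConst_pos (by linarith) hp.le))
  have hb := pow_pos (inv_pos.2 (Real.rpow_pos_of_pos ha (1 / p))) n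
  -- The constant is `b⁻ⁿ` times half of `perpSphereMass n`, where `b` is the factor in `h_{Π_p K} =
  -- b N`.
  refine ⟨_, mul_pos hb (half_pos hM), fun K h0 u => ?_⟩
  obtain ⟨N, hNc, hN⟩ := LpRolodex.exists_seminorm_eq_lpEnergy_rpow (by omega) hp K h0
  have key := LpRolodex.volume_polarLpProjectionBody hn hp K h0 N hN
  rw [LpRolodex.volume_seminorm_ball_eq hn hNc hN u, ← mul_assoc, ← ENNReal.ofReal_mul hb.le] at key
  refine ⟨?_, key⟩
  rw [key, LpRolodex.rolodexMeasure_apply hn u (LpRolodex.measurableSet_rolodex hn hNc hN u)]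
  simp only [LpRolodex.lintegral_fiber_rolodex hn hNc hN u]
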